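/- For a prime power $q$ let $\mathbb{F}_q$ be the finite field with $q$ elements, and for integers $0\le k\le n$ and $d$ let $A_q(n,d;k)$ denote the maximum cardinality of a set $\mathcal{C}$ of $k$-dimensional subspaces of $\mathbb{F}_q^n$ such that $d_S(U,W):=\dim(U)+\dim(W)-2\dim(U\cap W)\ge d$ for all $U,W\in\mathcal{C}$ with $U\neq W$. Then, for every prime power $q$, $$ A_q(17,4;6)\ \ge\ q^{55} + q^{51} + q^{49} + 8q^{47} + 3q^{45} + 3q^{44} + 5q^{43} + q^{42} + 5q^{41} + 9q^{40} + 22q^{39} + 7q^{38} + 11q^{37} + 13q^{36} + 19q^{35} + 3q^{34} + 17q^{33} + 15q^{32} + 69q^{31} + 20q^{30} + 49q^{29} + 22q^{28} + 33q^{27} + 15q^{26} + 23q^{25} + 20q^{24} + 38q^{23} + 17q^{22} + 29q^{21} + 24q^{20} + 40q^{19} + 19q^{18} + 20q^{17} + 15q^{16} + 28q^{15} + 15q^{14} + 13q^{13} + 8q^{12} + 7q^{11} + 5q^{10} + 3q^{9} + 10q^{8} + q^{7} + 2q^{6} + q^{5} + 2q^{4} + q^{3} + q^{2} + q + 1. $$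 -/

import Mathlib

/-- The subspace distance `dim U + dim W - 2 dim (U ∩ W)`. The subtraction of natural numbers never
truncates on finite-dimensional spaces, as `U ∩ W` is contained both in `U` and in `W`. -/
noncomputable def subspaceDist {F V : Type*} [Field F] [AddCommGroup V] [Module F V]
    (U W : Submodule F V) : ℕ :=
  Module.finrank F U + Module.finrank F W - 2 * Module.finrank F (U ⊓ W : Submodule F V)

/-- `C` is a constant dimension code in the set of all `k`-dimensional subspaces of `F ^ n`, with
minimum subspace distance at least `d`. -/
structure IsCDC (F : Type*) [Field F] (n d k : ℕ) (C : Finset (Submodule F (Fin n → F))) :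
    Prop where
  finrank_eq : ∀ U ∈ C, Module.finrank F U = k
  le_dist : ∀ U ∈ C, ∀ W ∈ C, U ≠ W → d ≤ subspaceDist U W

/-- The maximum possible cardinality `A_q(n, d; k)` of a constant dimension code of `k`-dimensional
subspaces of `F ^ n` with minimum subspace distance at least `d`, where `F` is a field with `q`
elements. -/
noncomputable def maxCDC (F : Type*) [Field F] (n d k : ℕ) : ℕ :=
  sSup {M : ℕ | ∃ C : Finset (Submodule F (Fin n → F)), IsCDC F n d k C ∧ C.card = M}

/-- Over a finite field the supremum in the definition of `maxCDC` is an attained maximum. -/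
theorem maxCDC_isGreatest (F : Type*) [Field F] [Finite F] (n d k : ℕ) :
    IsGreatest {M : ℕ | ∃ C : Finset (Submodule F (Fin n → F)), IsCDC F n d k C ∧ C.card = M}
      (maxCDC F n d k) := by
  have hbdd : BddAbove
      {M : ℕ | ∃ C : Finset (Submodule F (Fin n → F)), IsCDC F n d k C ∧ C.card = M} := by
    have : Finite (Submodule F (Fin n → F)) :=
      Finite.of_injective (fun U => (U : Set (Fin n → F))) SetLike.coe_injective
    have := Fintype.ofFinite (Submodule F (Fin n → F))
    refine ⟨Fintype.card (Submodule F (Fin n → F)), ?_⟩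
    rintro M ⟨C, -, rfl⟩
    exact Finset.card_le_univ C
  exact ⟨Nat.sSup_mem ⟨0, ∅, ⟨by simp, by simp⟩, rfl⟩ hbdd, fun M hM => le_csSup hbdd hM⟩

/-! This is the multilevel (Echelon-Ferrers) construction. Subspaces are sorted by the pivot set of
their reduced row echelon form. If two pivot sets share at most four of their six elements, any two
subspaces with these pivots meet in dimension at most four, hence are at distance at least four
(`finrank_inf_echelonSpace_le`). For equal pivot sets the same holds once the difference of the free
entries has rank at least two (`finrank_inf_echelonSpace_add_two_le`), so each pivot set can carry a
linear code of matrices without elements of rank one (`exists_rank_metric_code`).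

`sum_pow_le_maxCDC` adds up the sizes of these codes. What remains is an explicit binary code of
length 17, weight 6 and Hamming distance 4, the list `skeleton`, and a count of its words by
attached dimension. The resulting polynomial is not the stated one, but exceeds it for every q ≥ 2.
-/

/-! ### Rank-metric codes from field extensions. -/

/-- Vectors spanning a space of dimension at least the size of a finite set of indices can be chosen
independent on that set. -/
theorem exists_linearIndepOn_of_card_le_finrank {F L ι : Type*} [Field F] [AddCommGroup L]
    [Module F L] (R : Finset ι) (hR : R.card ≤ Module.finrank F L) :
    ∃ β : ι → L, LinearIndepOn F β (R : Set ι) := by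
  classical
  obtain ⟨f, hf⟩ := exists_linearIndependent_of_le_finrank hR
  refine ⟨fun i => if h : i ∈ R then f (R.equivFin ⟨i, h⟩) else 0, ?_⟩
  have h := hf.comp _ R.equivFin.injective
  have he : ∀ x : (R : Set ι), f (R.equivFin x) =
      if h : (x : ι) ∈ R then f (R.equivFin ⟨x, h⟩) else 0 := fun x => by
    rw [dif_pos (Finset.mem_coe.1 x.2)]
    rfl
  rw [LinearIndepOn, ← funext he]
  exact h

/-- A finite field has an extension of every positive degree. -/
theorem exists_field_extension_finrank (F : Type*) [Field F] [Finite F] (m : ℕ) (hm : m ≠ 0) :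
    ∃ (L : Type) (_ : Field L) (_ : Algebra F L) (_ : Module.Finite F L),
      Module.finrank F L = m := by
  obtain ⟨p, hp⟩ := CharP.exists F
  have : Fact p.Prime := ⟨(CharP.char_is_prime_or_zero F p).resolve_right
    (CharP.char_ne_zero_of_finite F p)⟩
  have : NeZero m := ⟨hm⟩
  exact ⟨FiniteField.Extension F p m, inferInstance, inferInstance, inferInstance,
    FiniteField.finrank_extension F p m⟩

/-- Ferrers diagram rank-metric codes with minimum rank distance two: for every set `E` of cells
contained in at most `m` rows and at most `m` columns there is a linear space of matrices supported
on `E`, of codimension at most `m`, that contains no matrix of rank one. -/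
theorem exists_rank_metric_code {F : Type*} [Field F] [Finite F] {ι κ : Type*} [Fintype ι]
    [Fintype κ] [DecidableEq ι] [DecidableEq κ] (E : Finset (ι × κ)) (m : ℕ)
    (hrow : (E.image Prod.fst).card ≤ m) (hcol : (E.image Prod.snd).card ≤ m) :
    ∃ K : Submodule F (Matrix ι κ F), E.card ≤ Module.finrank F K + m ∧
      (∀ D ∈ K, ∀ s c, (s, c) ∉ E → D s c = 0) ∧
      ∀ x y, Matrix.vecMulVec x y ∈ K → Matrix.vecMulVec x y = 0 := by
  rcases eq_or_ne m 0 with rfl | hm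
  · have hE : E = ∅ := by simpa using hrow
    exact ⟨⊥, by simp [hE], by simp +contextual, by simp⟩
  obtain ⟨L, _, _, _, hL⟩ := exists_field_extension_finrank F m hm
  obtain ⟨β, hβ⟩ := exists_linearIndepOn_of_card_le_finrank (F := F) (L := L) _ (hL ▸ hrow)
  obtain ⟨α, hα⟩ := exists_linearIndepOn_of_card_le_finrank (F := F) (L := L) _ (hL ▸ hcol)
  rw [linearIndepOn_finset_iff] at hα hβ
  -- On a rank-one matrix `Φ` is a product of two elements of the field `L`, so it vanishes only if
  -- one factor does.
  let Φ : Matrix ι κ F →ₗ[F] L :=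
    { toFun := fun D => ∑ s, ∑ c, D s c • (β s * α c)
      map_add' := by intro A B; simp [add_smul, Finset.sum_add_distrib]
      map_smul' := by intro a A; simp [mul_smul, Finset.smul_sum] }
  let R : Matrix ι κ F →ₗ[F] ({x // x ∉ E} → F) :=
    { toFun := fun D x => D x.1.1 x.1.2
      map_add' := by intro A B; rfl
      map_smul' := by intro a A; rfl }
  have hsupp : ∀ D ∈ LinearMap.ker (R.prod Φ), ∀ s c, (s, c) ∉ E → D s c = 0 := by
    intro D hD s c h
    have h1 : R D = 0 := congrArg Prod.fst (LinearMap.mem_ker.1 hD)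
    exact congrFun h1 ⟨(s, c), h⟩
  refine ⟨LinearMap.ker (R.prod Φ), ?_, hsupp, ?_⟩
  -- Vanishing off `E` costs one equation per cell outside `E`, and `Φ` costs at most `m`, the
  -- degree of `L`.
  · have h1 := LinearMap.finrank_range_add_finrank_ker (R.prod Φ)
    have h2 := Submodule.finrank_le (LinearMap.range (R.prod Φ))
    have h3 : Fintype.card {x // x ∉ E} = Fintype.card (ι × κ) - E.card := by
      rw [Fintype.card_subtype_compl, Fintype.card_coe]
    have h4 := E.card_le_univ
    rw [Module.finrank_prod, Module.finrank_pi, hL, h3] at h2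
    rw [Module.finrank_matrix, Module.finrank_self, mul_one] at h1
    rw [Fintype.card_prod] at h2 h4
    omega
  · intro x y hxy
    by_contra hne
    have hx : ∃ s, x s ≠ 0 := by
      by_contra! h
      exact hne (by ext s c; simp [Matrix.vecMulVec_apply, h])
    have hy : ∃ c, y c ≠ 0 := by
      by_contra! h
      exact hne (by ext s c; simp [Matrix.vecMulVec_apply, h])
    obtain ⟨s, hs⟩ := hx
    obtain ⟨c, hc⟩ := hy
    -- The supports of `x` and `y` span a rectangle inside `E`, so only indices where `β` and `α`
    -- are independent occur.
    have hE : ∀ s c, x s ≠ 0 → y c ≠ 0 → (s, c) ∈ E := by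
      intro s c hs hc
      by_contra h
      have := hsupp _ hxy s c h
      simp [Matrix.vecMulVec_apply, hs, hc] at this
    have h1 : Φ (Matrix.vecMulVec x y) = 0 := congrArg Prod.snd (LinearMap.mem_ker.1 hxy)
    have h2 : Φ (Matrix.vecMulVec x y) = (∑ s, x s • β s) * ∑ c, y c • α c := by
      change ∑ s, ∑ c, Matrix.vecMulVec x y s c • (β s * α c) = _
      rw [Finset.sum_mul_sum]
      simp only [Matrix.vecMulVec_apply, smul_mul_smul_comm]
    rw [h2] at h1
    rcases mul_eq_zero.1 h1 with h | h
    · refine hs (hβ x ?_ s (Finset.mem_image.2 ⟨(s, c), hE s c hs hc, rfl⟩))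
      rw [← h]
      refine Finset.sum_subset (Finset.subset_univ _) fun t _ ht => ?_
      have : x t = 0 := by
        by_contra h0
        exact ht (Finset.mem_image.2 ⟨(t, c), hE t c h0 hc, rfl⟩)
      simp [this]
    · refine hc (hα y ?_ c (Finset.mem_image.2 ⟨(s, c), hE s c hs hc, rfl⟩))
      rw [← h]
      refine Finset.sum_subset (Finset.subset_univ _) fun t _ ht => ?_
      have : y t = 0 := by
        by_contra h0
        exact ht (Finset.mem_image.2 ⟨(s, t), hE s t hs h0, rfl⟩)
      simp [this]

/-! ### Echelon forms and intersection dimensions. -/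

/-- The cells right of a pivot in a row indexed by an element of the pivot set `S` that are not in a
pivot column: the free entries of the reduced row echelon matrices with pivot set `S`. -/
def freeCells {n : ℕ} (S : Finset (Fin n)) : Finset (Fin n × Fin n) :=
  Finset.univ.filter fun x => x.1 ∈ S ∧ x.2 ∉ S ∧ x.1 < x.2

theorem mem_freeCells {n : ℕ} {S : Finset (Fin n)} {s c : Fin n} :
    (s, c) ∈ freeCells S ↔ s ∈ S ∧ c ∉ S ∧ s < c := by simp [freeCells]

/-- The row space of the reduced row echelon matrix with pivot set `S` and free entries `D`, given
by its equations. -/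
def echelonSpace {F : Type*} [Field F] {n : ℕ} (S : Finset (Fin n))
    (D : Matrix (Fin n) (Fin n) F) : Submodule F (Fin n → F) where
  carrier := {v | ∀ c, c ∉ S → v c = Matrix.vecMul v D c}
  add_mem' := by
    intro a b ha hb c hc
    simp [Matrix.add_vecMul, ha c hc, hb c hc]
  zero_mem' := by simp
  smul_mem' := by
    intro r a ha c hc
    simp [Matrix.smul_vecMul, ha c hc]

section Echelon

variable {F : Type*} [Field F] {n : ℕ} {S S' : Finset (Fin n)} {D D' : Matrix (Fin n) (Fin n) F}

theorem mem_echelonSpace {v : Fin n → F} :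
    v ∈ echelonSpace S D ↔ ∀ c, c ∉ S → v c = Matrix.vecMul v D c := Iff.rfl

theorem exists_leading {v : Fin n → F} (hv : v ≠ 0) : ∃ c, v c ≠ 0 ∧ ∀ t < c, v t = 0 := by
  have h : ∃ c, v c ≠ 0 := Function.ne_iff.1 hv
  obtain ⟨c, hc, hmin⟩ := WellFounded.has_min (wellFounded_lt (α := Fin n)) {c | v c ≠ 0} h
  exact ⟨c, hc, fun t ht => by_contra fun h0 => hmin t h0 ht⟩

theorem vecMul_apply_eq_zero {v : Fin n → F} {c : Fin n} (h : ∀ s, v s * D s c = 0) :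
    Matrix.vecMul v D c = 0 := by
  change ∑ s, v s * D s c = 0
  exact Finset.sum_eq_zero fun s _ => h s

/-- At a non-pivot position the coordinate is a combination of earlier coordinates, so it cannot be
the first nonzero one. -/
theorem leading_mem_pivots (hD : ∀ s c, (s, c) ∉ freeCells S → D s c = 0) {v : Fin n → F}
    (hv : v ∈ echelonSpace S D) {c : Fin n} (hc : v c ≠ 0) (hlt : ∀ t < c, v t = 0) : c ∈ S := by
  by_contra hcS
  apply hc
  rw [hv c hcS]
  refine vecMul_apply_eq_zero fun s => ?_
  by_cases hs : s < c
  · simp [hlt s hs]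
  · rw [hD s c fun h => hs (mem_freeCells.1 h).2.2, mul_zero]

theorem finrank_le_card_of_forall_exists_ne_zero {X : Submodule F (Fin n → F)}
    {T : Finset (Fin n)} (h : ∀ v ∈ X, v ≠ 0 → ∃ s ∈ T, v s ≠ 0) :
    Module.finrank F X ≤ T.card := by
  have h1 := LinearMap.finrank_le_finrank_of_injective
    (f := (LinearMap.funLeft F F (Subtype.val : T → Fin n)) ∘ₗ X.subtype) (by
      rw [← LinearMap.ker_eq_bot, LinearMap.ker_eq_bot']
      intro v hv
      by_contra hne
      obtain ⟨s, hs, hvs⟩ := h v v.2 (by simpa using hne)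
      exact hvs (congrFun hv ⟨s, hs⟩))
  simpa using h1

/-- The leading position of a nonzero common vector is a pivot of both spaces, so restriction to `S
∩ S'` is injective on the intersection. -/
theorem finrank_inf_echelonSpace_le (hD : ∀ s c, (s, c) ∉ freeCells S → D s c = 0)
    (hD' : ∀ s c, (s, c) ∉ freeCells S' → D' s c = 0) :
    Module.finrank F (echelonSpace S D ⊓ echelonSpace S' D' : Submodule F (Fin n → F))
      ≤ (S ∩ S').card := by
  refine finrank_le_card_of_forall_exists_ne_zero fun v hv hne => ?_
  obtain ⟨c, hc, hlt⟩ := exists_leading hne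
  exact ⟨c, Finset.mem_inter.2 ⟨leading_mem_pivots hD hv.1 hc hlt,
    leading_mem_pivots hD' hv.2 hc hlt⟩, hc⟩

theorem finrank_echelonSpace (hD : ∀ s c, (s, c) ∉ freeCells S → D s c = 0) :
    Module.finrank F (echelonSpace S D) = S.card := by
  apply le_antisymm
  · have := finrank_inf_echelonSpace_le hD hD
    rwa [inf_idem, Finset.inter_self] at this
  · let f : (Fin n → F) →ₗ[F] ({c // c ∉ S} → F) :=
      LinearMap.funLeft F F Subtype.val ∘ₗ (LinearMap.id - D.vecMulLinear)
    have hf : LinearMap.ker f = echelonSpace S D := by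
      ext v
      rw [LinearMap.mem_ker, mem_echelonSpace, funext_iff, Subtype.forall]
      refine forall₂_congr fun c hc => ?_
      simp [f, LinearMap.funLeft_apply, sub_eq_zero]
    have h1 := LinearMap.finrank_range_add_finrank_ker f
    have h2 := Submodule.finrank_le (LinearMap.range f)
    have h3 : Fintype.card {x // x ∉ S} = Fintype.card (Fin n) - S.card := by
      rw [Fintype.card_subtype_compl, Fintype.card_coe]
    have h4 := S.card_le_univ
    rw [Module.finrank_pi, h3] at h2
    rw [hf, Module.finrank_pi] at h1
    omega

/-- The intersection lies in the kernel of `D - D'` acting on the first space, and the image of this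
action contains every row of `D - D'`. Since `x` or `y` may be zero, `hrank` also excludes `D = D'`.
-/
theorem finrank_inf_echelonSpace_add_two_le (hD : ∀ s c, (s, c) ∉ freeCells S → D s c = 0)
    (hD' : ∀ s c, (s, c) ∉ freeCells S → D' s c = 0)
    (hrank : ∀ x y, D - D' ≠ Matrix.vecMulVec x y) :
    Module.finrank F (echelonSpace S D ⊓ echelonSpace S D' : Submodule F (Fin n → F)) + 2
      ≤ S.card := by
  have hA : ∀ s c, (s, c) ∉ freeCells S → (D - D') s c = 0 := by
    intro s c h
    simp [hD s c h, hD' s c h]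
  set A := D - D' with hAdef
  let T : echelonSpace S D →ₗ[F] (Fin n → F) := A.vecMulLinear.domRestrict _
  have hker : Module.finrank F (echelonSpace S D ⊓ echelonSpace S D' : Submodule F (Fin n → F))
      ≤ Module.finrank F (LinearMap.ker T) := by
    rw [← Submodule.finrank_map_subtype_eq (echelonSpace S D) (LinearMap.ker T)]
    refine Submodule.finrank_mono fun v hv => ?_
    refine ⟨⟨v, hv.1⟩, ?_, rfl⟩
    change Matrix.vecMul v A = 0
    funext c
    by_cases hc : c ∈ S
    · exact vecMul_apply_eq_zero fun s => by
        rw [hA s c fun h => (mem_freeCells.1 h).2.1 hc, mul_zero]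
    · rw [hAdef, Matrix.vecMul_sub, Pi.sub_apply, ← hv.1 c hc, ← hv.2 c hc, sub_self, Pi.zero_apply]
  have hrange : 2 ≤ Module.finrank F (LinearMap.range T) := by
    by_contra! hlt
    obtain ⟨y, hy⟩ := finrank_le_one_iff.1 (Nat.le_of_lt_succ hlt)
    have hrow : ∀ s, ∃ a : F, A s = a • (y : Fin n → F) := by
      intro s
      by_cases hs : s ∈ S
      · have hDs : Matrix.vecMul (D s) D = 0 := by
          funext c
          refine vecMul_apply_eq_zero fun t => ?_
          by_cases ht : t ∈ S
          · rw [hD s t fun h => (mem_freeCells.1 h).2.1 ht, zero_mul]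
          · rw [hD t c fun h => ht (mem_freeCells.1 h).1, mul_zero]
        have hDA : Matrix.vecMul (D s) A = 0 := by
          funext c
          refine vecMul_apply_eq_zero fun t => ?_
          by_cases ht : t ∈ S
          · rw [hD s t fun h => (mem_freeCells.1 h).2.1 ht, zero_mul]
          · rw [hA t c fun h => ht (mem_freeCells.1 h).1, mul_zero]
        -- This is the row of the echelon matrix with pivot `s`. Its image under `A` is `A s`,
        -- because `D s` lives off `S` while `A` has nonzero rows only in `S`.
        have hu : Pi.single s 1 + D s ∈ echelonSpace S D := by
          intro c hc
          have hcs : c ≠ s := fun h => hc (h ▸ hs)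
          rw [Matrix.add_vecMul, hDs, add_zero, Matrix.single_one_vecMul]
          simp [Pi.single_eq_of_ne hcs]
        obtain ⟨a, ha⟩ := hy ⟨T ⟨_, hu⟩, LinearMap.mem_range_self _ _⟩
        refine ⟨a, ?_⟩
        have h1 : a • (y : Fin n → F) = Matrix.vecMul (Pi.single s 1 + D s) A :=
          congrArg Subtype.val ha
        rw [h1, Matrix.add_vecMul, hDA, add_zero, Matrix.single_one_vecMul]
        rfl
      · exact ⟨0, by funext c; rw [hA s c fun h => hs (mem_freeCells.1 h).1]; simp⟩
    choose a ha using hrow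
    refine hrank a y ?_
    ext s c
    rw [ha s]
    rfl
  have h1 := LinearMap.finrank_range_add_finrank_ker T
  rw [finrank_echelonSpace hD] at h1
  omega

end Echelon

/-! ### The multilevel construction. -/

/-- The multilevel construction for subspace distance four. -/
theorem sum_pow_le_maxCDC {F : Type*} [Field F] [Finite F] {n k : ℕ} {ι : Type*} [Fintype ι]
    (S : ι → Finset (Fin n)) (hk : ∀ i, (S i).card = k)
    (hdist : ∀ i j, i ≠ j → (S i ∩ S j).card + 2 ≤ k) (m : ι → ℕ)
    (hrow : ∀ i, ((freeCells (S i)).image Prod.fst).card ≤ m i)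
    (hcol : ∀ i, ((freeCells (S i)).image Prod.snd).card ≤ m i) :
    ∑ i, Nat.card F ^ ((freeCells (S i)).card - m i) ≤ maxCDC F n 4 k := by
  classical
  choose K hKdim hKsupp hKrank using fun i =>
    exists_rank_metric_code (F := F) (freeCells (S i)) (m i) (hrow i) (hcol i)
  have (i : ι) : Finite (K i) := Finite.of_injective _ Subtype.val_injective
  have (i : ι) : Fintype (K i) := Fintype.ofFinite _
  let U : (Σ i, K i) → Submodule F (Fin n → F) := fun x => echelonSpace (S x.1) x.2.1
  have hU : ∀ x, Module.finrank F (U x) = k := fun x =>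
    (finrank_echelonSpace (hKsupp x.1 _ x.2.2)).trans (hk x.1)
  have hinf : ∀ x y, x ≠ y → Module.finrank F (U x ⊓ U y : Submodule F (Fin n → F)) + 2 ≤ k := by
    rintro ⟨i, D, hD⟩ ⟨j, D', hD'⟩ hne
    rcases eq_or_ne i j with rfl | hij
    · refine (finrank_inf_echelonSpace_add_two_le (hKsupp i _ hD) (hKsupp i _ hD') ?_).trans
        (hk i).le
      intro x y hxy
      have h0 := hKrank i x y (hxy ▸ (K i).sub_mem hD hD')
      rw [h0, sub_eq_zero] at hxy
      subst hxy
      exact hne rfl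
    · exact (Nat.add_le_add_right
        (finrank_inf_echelonSpace_le (hKsupp i _ hD) (hKsupp j _ hD')) 2).trans (hdist i j hij)
  have hinj : Function.Injective U := by
    intro x y hxy
    by_contra hne
    have := hinf x y hne
    rw [hxy, inf_idem, hU] at this
    omega
  have hC : IsCDC F n 4 k (Finset.univ.map ⟨U, hinj⟩) := by
    constructor
    · simp only [Finset.mem_map, Finset.mem_univ, true_and, Function.Embedding.coeFn_mk]
      rintro _ ⟨x, rfl⟩
      exact hU x
    · simp only [Finset.mem_map, Finset.mem_univ, true_and, Function.Embedding.coeFn_mk]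
      rintro _ ⟨x, rfl⟩ _ ⟨y, rfl⟩ hne
      have := hinf x y fun h => hne (h ▸ rfl)
      rw [subspaceDist, hU, hU]
      omega
  refine le_trans ?_ ((maxCDC_isGreatest F n 4 k).2 ⟨_, hC, rfl⟩)
  rw [Finset.card_map, Finset.card_univ, Fintype.card_sigma]
  refine Finset.sum_le_sum fun i _ => ?_
  rw [← Nat.card_eq_fintype_card, Module.natCard_eq_pow_finrank (K := F) (V := K i)]
  exact Nat.pow_le_pow_right (Nat.card_pos (α := F)) (by have := hKdim i; omega)

/-! ### Counting free cells. -/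

/-- These pairs are the cells right of a pivot that fall into pivot columns, to be discarded when
counting free cells. -/
theorem card_lt_pairs {n : ℕ} (S : Finset (Fin n)) :
    2 * ((S ×ˢ S).filter fun x => x.1 < x.2).card + S.card = S.card * S.card := by
  have h1 : ((S ×ˢ S).filter fun x => x.2 < x.1).card =
      ((S ×ˢ S).filter fun x => x.1 < x.2).card := by
    refine Finset.card_nbij' Prod.swap Prod.swap ?_ ?_ ?_ ?_ <;>
      simp +contextual [Set.MapsTo, Set.LeftInvOn]
  have h2 : S.offDiag = ((S ×ˢ S).filter fun x => x.1 < x.2) ∪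
      ((S ×ˢ S).filter fun x => x.2 < x.1) := by
    ext ⟨a, b⟩
    simp only [Finset.mem_offDiag, Finset.mem_union, Finset.mem_filter, Finset.mem_product,
      ne_iff_lt_or_gt]
    tauto
  have h3 := congrArg Finset.card h2
  rw [Finset.card_union_of_disjoint, h1, Finset.offDiag_card] at h3
  · have := Nat.le_mul_self S.card
    omega
  · exact Finset.disjoint_filter.2 fun x _ hx => not_lt_of_gt hx

/-- The number of free cells in terms of the sum of the pivot positions. -/
theorem card_freeCells {n : ℕ} (S : Finset (Fin n)) :
    2 * (freeCells S).card + S.card * S.card =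
      2 * ∑ s ∈ S, (n - 1 - (s : ℕ)) + S.card := by
  have h1 : (S ×ˢ Finset.univ).filter (fun x => x.1 < x.2) =
      freeCells S ∪ ((S ×ˢ S).filter fun x => x.1 < x.2) := by
    ext ⟨a, b⟩
    simp only [Finset.mem_filter, Finset.mem_product, Finset.mem_univ, Finset.mem_union,
      mem_freeCells]
    tauto
  have h2 : ((S ×ˢ Finset.univ).filter (fun x => x.1 < x.2)).card =
      ∑ s ∈ S, (n - 1 - (s : ℕ)) := by
    rw [Finset.card_filter, Finset.sum_product]
    refine Finset.sum_congr rfl fun s _ => ?_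
    rw [← Finset.card_filter, ← Fin.card_Ioi]
    congr 1
    ext
    simp
  have h3 : Disjoint (freeCells S) ((S ×ˢ S).filter fun x => x.1 < x.2) := by
    rw [Finset.disjoint_left]
    rintro ⟨a, b⟩ h h'
    exact (mem_freeCells.1 h).2.1 (Finset.mem_product.1 (Finset.mem_filter.1 h').1).2
  rw [← h2, h1, Finset.card_union_of_disjoint h3]
  have := card_lt_pairs S
  omega

theorem card_rows_freeCells_le {n : ℕ} (S : Finset (Fin n)) :
    ((freeCells S).image Prod.fst).card ≤ S.card := by
  refine Finset.card_le_card fun s hs => ?_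
  obtain ⟨⟨a, b⟩, h, rfl⟩ := Finset.mem_image.1 hs
  exact (mem_freeCells.1 h).1

theorem card_columns_freeCells_le {n : ℕ} (S : Finset (Fin n)) (z : Fin n) (hz : ∀ s ∈ S, z ≤ s) :
    ((freeCells S).image Prod.snd).card ≤ n - z - S.card := by
  have hS : S ⊆ Finset.Ici z := fun s hs => Finset.mem_Ici.2 (hz s hs)
  rw [← Fin.card_Ici, ← Finset.card_sdiff_of_subset hS]
  refine Finset.card_le_card fun c hc => ?_
  obtain ⟨⟨a, b⟩, h, rfl⟩ := Finset.mem_image.1 hc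
  obtain ⟨h1, h2, h3⟩ := mem_freeCells.1 h
  exact Finset.mem_sdiff.2 ⟨Finset.mem_Ici.2 ((hz a h1).trans h3.le), h2⟩

/-! ### The explicit skeleton code and its verification. -/

/-- The positions of the ones in the binary expansion of `a`, as a set of coordinates of `F ^ 17`. -/
def pivots (a : ℕ) : Finset (Fin 17) := Finset.univ.filter fun i => a.testBit i

/-- The lowest position of a one in the binary expansion of `a`. -/
def lowestPivot (a : ℕ) : Fin 17 :=
  Fin.ofNat 17 (Finset.univ.filter fun i : Fin 17 => a % 2 ^ (i.val + 1) = 0).card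

/-- The dimension of the rank metric code that is attached to a word of weight six. -/
def codeDim (a : ℕ) : ℕ := 81 - ∑ i ∈ pivots a, i.val - max 6 (11 - (lowestPivot a).val)

/-- The numbers obtained from `a` by deleting a one from the binary expansion. -/
def deletions (a : ℕ) : List ℕ := ((List.range 17).filter a.testBit).map fun i => a ^^^ 2 ^ i

/-- The numbers in the list are pairwise distinct and are not positions of ones of `acc`. -/
def allNew : ℕ → List ℕ → Bool
  | _, [] => true
  | acc, x :: l => !acc.testBit x && allNew (acc ||| 2 ^ x) l

/-- A bit mask of the values already seen replaces the quadratic number of pairwise comparisons. -/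
theorem nodup_of_allNew {acc : ℕ} {l : List ℕ} (h : allNew acc l = true) :
    l.Nodup ∧ ∀ x ∈ l, acc.testBit x = false := by
  induction l generalizing acc with
  | nil => simp
  | cons y l ih =>
    simp only [allNew, Bool.and_eq_true, Bool.not_eq_true'] at h
    obtain ⟨hl, hacc⟩ := ih h.2
    simp only [Nat.testBit_or, Bool.or_eq_false_iff, Nat.testBit_two_pow,
      decide_eq_false_iff_not] at hacc
    refine ⟨List.nodup_cons.2 ⟨fun hy => (hacc y hy).2 rfl, hl⟩, ?_⟩
    rintro x (_ | ⟨_, hx⟩)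
    · exact h.1
    · exact (hacc x hx).1

/-- Distinct words of equal weight at Hamming distance two differ by moving a single one; deleting
it from each leaves the same word. Hence disjoint deletion lists certify distance at least four. -/
theorem exists_common_deletion {a b : ℕ} (ha : a < 2 ^ 17) (hb : b < 2 ^ 17) (hab : a ≠ b)
    (hcard : (pivots a).card = (pivots b).card)
    (hinter : (pivots a).card ≤ (pivots a ∩ pivots b).card + 1) :
    ∃ x ∈ deletions a, x ∈ deletions b := by
  have hne : pivots a ≠ pivots b := by
    intro h
    refine hab (Nat.eq_of_testBit_eq fun i => ?_)
    by_cases hi : i < 17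
    · have := Finset.ext_iff.1 h ⟨i, hi⟩
      simp only [pivots, Finset.mem_filter, Finset.mem_univ, true_and] at this
      exact Bool.eq_iff_iff.2 this
    · have h17 : 2 ^ 17 ≤ 2 ^ i := Nat.pow_le_pow_right (by norm_num) (by omega)
      rw [Nat.testBit_lt_two_pow (ha.trans_le h17), Nat.testBit_lt_two_pow (hb.trans_le h17)]
  have key : ∀ {A B : Finset (Fin 17)}, A.card = B.card → A.card ≤ (A ∩ B).card + 1 → A ≠ B →
      ∃ i, A \ B = {i} := by
    intro A B h1 h2 h3
    rw [← Finset.card_eq_one]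
    have h4 := Finset.card_sdiff_add_card_inter A B
    have h5 : (A \ B).card ≠ 0 := by
      rw [Finset.card_ne_zero, Finset.sdiff_nonempty]
      exact fun h => h3 (Finset.eq_of_subset_of_card_le h h1.ge)
    omega
  obtain ⟨i, hi⟩ := key hcard hinter hne
  obtain ⟨j, hj⟩ := key hcard.symm (by rwa [Finset.inter_comm, ← hcard]) hne.symm
  have hi' := fun t => Finset.ext_iff.1 hi t
  have hj' := fun t => Finset.ext_iff.1 hj t
  simp only [pivots, Finset.mem_sdiff, Finset.mem_filter, Finset.mem_univ, true_and,
    Finset.mem_singleton] at hi' hj'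
  have hx : a ^^^ 2 ^ i.val = b ^^^ 2 ^ j.val := by
    refine Nat.eq_of_testBit_eq fun t => ?_
    rw [Nat.testBit_xor, Nat.testBit_xor, Nat.testBit_two_pow, Nat.testBit_two_pow]
    by_cases ht : t < 17
    · have h1 := hi' ⟨t, ht⟩
      have h2 := hj' ⟨t, ht⟩
      simp only [Fin.ext_iff, eq_comm (a := t)] at h1 h2
      simp only [← h1, ← h2]
      cases a.testBit t <;> cases b.testBit t <;> rfl
    · have h17 : 2 ^ 17 ≤ 2 ^ t := Nat.pow_le_pow_right (by norm_num) (by omega)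
      rw [Nat.testBit_lt_two_pow (ha.trans_le h17), Nat.testBit_lt_two_pow (hb.trans_le h17)]
      have h1 : i.val ≠ t := by omega
      have h2 : j.val ≠ t := by omega
      simp [h1, h2]
  refine ⟨a ^^^ 2 ^ i.val, List.mem_map.2 ⟨i, ?_, rfl⟩, hx ▸ List.mem_map.2 ⟨j, ?_, rfl⟩⟩
  · exact List.mem_filter.2 ⟨List.mem_range.2 i.2, ((hi' i).2 rfl).1⟩
  · exact List.mem_filter.2 ⟨List.mem_range.2 j.2, ((hj' j).2 rfl).1⟩

/-- Words of length seventeen and weight six with pairwise Hamming distance at least four, written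
as numbers whose binary expansion has its least significant digit at the first coordinate. -/
def skeleton : List ℕ :=
  [63, 207, 343, 243, 363, 411, 423, 603, 615, 663, 783, 252, 683, 1117, 1134, 1182, 2142, 819,
  1197, 2157, 2205, 3087, 2222, 828, 1334, 4214, 4381, 5143, 1337, 1589, 2357, 4217, 4277, 4398,
  4638, 8309, 8478, 963, 1370, 1381, 1429, 1594, 1622, 2362, 2614, 3123, 4282, 4653, 5163, 6171,
  6183, 8314, 8374, 8493, 8733, 9243, 9255, 10263, 12303, 2393, 2406, 2454, 2617, 2645, 8377, 8750,
  972, 1450, 1478, 1641, 1689, 1702, 3132, 10283, 16597, 16718, 17479, 1481, 1733, 2473, 2501, 2666,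
  2714, 2725, 16602, 16614, 16781, 16973, 32982, 33101, 1008, 1738, 2506, 2758, 3267, 12339, 16617,
  17038, 17547, 18507, 18567, 32985, 32997, 33166, 33358, 33867, 33927, 34887, 49167, 2761, 33002,
  33421, 1873, 3276, 4562, 4933, 5443, 12348, 16754, 17174, 17683, 20563, 20743, 34955, 65884,
  66643, 66823, 69703, 81943, 1890, 1938, 2898, 4577, 4820, 4938, 4998, 8660, 9030, 16817, 17009,
  17177, 17189, 33140, 33557, 1953, 2913, 2961, 3312, 3412, 3843, 4834, 5001, 5336, 5452, 5763,
  6531, 6723, 8674, 8914, 9033, 9093, 9603, 9795, 10563, 12483, 17074, 17194, 17528, 17692, 17955,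
  18723, 18963, 20572, 20581, 20630, 20643, 21003, 24662, 24675, 24723, 24843, 25095, 33208, 33400,
  33562, 33574, 34083, 34323, 35091, 36949, 36963, 37011, 37131, 37383, 41043, 41223, 49203, 65905,
  65964, 66156, 66204, 66723, 67083, 67683, 67731, 67851, 68103, 69771, 73803, 73863, 81963, 98331,
  98343, 2978, 3432, 3480, 3672, 5348, 6353, 8932, 9098, 9425, 17588, 18548, 20586, 20633, 24665,
  33460, 33577, 33905, 36954, 65970, 66162, 3492, 3684, 3732, 3852, 5488, 5772, 6376, 6540, 6732,
  7237, 9448, 9612, 9804, 10456, 10572, 10883, 12492, 17964, 18616, 18732, 18972, 19478, 20652,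
  20762, 21013, 21518, 24684, 24732, 24741, 24853, 33970, 34092, 34332, 34930, 35100, 35363, 36972,
  37020, 37030, 37142, 41052, 41062, 41109, 41123, 41483, 49212, 66225, 66676, 69907, 3752, 7242,
  7302, 10465, 11334, 19481, 19493, 20777, 21030, 22541, 24746, 24870, 25613, 34993, 35861, 37033,
  37157, 37901, 41065, 41114, 66744, 67704, 3888, 5808, 5908, 6576, 6768, 7305, 9648, 9840, 10608,
  10892, 11337, 11397, 12528, 12632, 13059, 19498, 20788, 25114, 26638, 35372, 35866, 35878, 37401,
  38926, 41132, 41241, 41494, 41998, 49347, 67764, 70179, 74019, 74259, 5928, 6936, 10008, 11402,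
  12644, 12689, 12881, 21048, 24888, 25129, 35881, 37418, 41258, 41509, 43021, 6948, 7442, 10020,
  10928, 11028, 12712, 12904, 12952, 13068, 13394, 13574, 17888, 21553, 21577, 21637, 22598, 25140,
  37958, 49356, 69944, 69961, 70021, 70684, 70693, 71701, 74053, 74773, 82243, 4032, 7457, 7697,
  11048, 11537, 12961, 13409, 13460, 13577, 13829, 14420, 14597, 18128, 18896, 22578, 25650, 25674,
  25734, 26693, 34256, 37940, 42053, 70196, 74036, 7714, 11554, 11794, 13104, 13474, 13834, 14434,
  14482, 14602, 14854, 15363, 18248, 19168, 20936, 22666, 26673, 34528, 35296, 38026, 38968, 38985,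
  39045, 42040, 49392, 49496, 49923, 69986, 70232, 70706, 71721, 74066, 74121, 74296, 74793, 75804,
  75813, 77846, 82310, 82502, 82563, 82970, 82982, 98630, 98691, 98883, 99350, 11809, 14500, 14857,
  18308, 19268, 21185, 25025, 26761, 34628, 35536, 37316, 42121, 43060, 43082, 43142, 49505, 49554,
  49748, 70290, 74088, 74324, 77849, 15372, 19336, 19777, 21328, 21698, 21794, 22034, 22801, 25288,
  34696, 35656, 37576, 38168, 41416, 49572, 49762, 49809, 49932, 50258, 50437, 70312, 70760, 70801,
  70922, 71174, 71762, 71942, 74337, 74840, 75826, 77866, 82276, 82328, 83020, 98950, 99370, 13248,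
  19842, 20034, 21408, 25440, 25889, 26129, 26898, 35716, 36162, 37728, 38081, 41665, 42258, 49832,
  50276, 50328, 50442, 50694, 51281, 51462, 71780, 71832, 74402, 74850, 74898, 75857, 98708, 15408,
  20097, 21904, 22112, 22880, 23073, 25488, 25936, 26818, 36225, 36417, 37776, 38433, 39106, 39202,
  39442, 41808, 42178, 49968, 50337, 50697, 51304, 51348, 51465, 51717, 52227, 71842, 72202, 74916,
  82596, 83041, 83209, 83461, 84108, 84229, 99468, 100428, 27170, 36482, 38304, 38480, 39248, 41888,
  42336, 42530, 43297, 43537, 51362, 51722, 75944, 102449, 22273, 23184, 23632, 26272, 27040, 27216,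
  28994, 29720, 52236, 71233, 75972, 83248, 84129, 84489, 86128, 86284, 87043, 99601, 114757, 15552,
  23298, 23712, 26370, 27744, 29060, 29252, 29732, 38658, 39584, 40032, 42640, 43408, 43588, 45377,
  46097, 50112, 71104, 114762, 23816, 27393, 27792, 29314, 30760, 39681, 40080, 42753, 44112, 45442,
  45634, 52272, 61443, 72324, 75393, 76162, 76354, 84296, 84528, 86212, 90288, 90636, 92163, 99656,
  99876, 100545, 100644, 100884, 102924, 104451, 106608, 106764, 107523, 114825, 24068, 27908,
  40196, 43778, 44192, 45700, 46152, 53633, 54312, 57668, 58388, 83592, 102624, 28168, 40456, 44296,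
  55332, 59416, 61452, 72512, 75584, 78916, 94213, 100744, 100960, 16128, 47240, 52416, 78984,
  79944, 114978, 115224, 61488, 77316, 79136, 80001, 88129, 103041, 107080, 115233, 118790, 54592,
  79376, 80144, 116754, 80416, 91328, 110628, 52992, 54912, 55872, 58752, 58944, 61632, 115842,
  122897, 88448, 110736, 122920, 60032, 108864, 119056, 123012, 62208, 123394, 120840, 97280]

/-- The pairs of a value of `codeDim` and the number of words in `skeleton` with this value. -/
def skeletonDims : List (ℕ × ℕ) :=
  [(55, 1), (51, 1), (49, 1), (47, 8), (45, 3), (44, 3), (43, 5), (42, 1), (41, 5), (40, 9),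
  (39, 22), (38, 7), (37, 11), (36, 13), (35, 19), (34, 3), (33, 17), (32, 15), (31, 69), (30, 20),
  (29, 49), (28, 22), (27, 33), (26, 15), (25, 28), (24, 24), (23, 46), (22, 22), (21, 36),
  (20, 28), (19, 37), (18, 14), (17, 19), (16, 19), (15, 34), (14, 13), (13, 12), (12, 7), (11, 9),
  (10, 4), (9, 3), (8, 8), (7, 3), (6, 2), (5, 2), (4, 1), (3, 1), (2, 1), (0, 1)]

theorem skeleton_weight : ∀ a ∈ skeleton,
    a < 2 ^ 17 ∧ (pivots a).card = 6 ∧ ∀ i ∈ pivots a, lowestPivot a ≤ i := by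
  decide +kernel

theorem skeleton_nodup : skeleton.Nodup :=
  (nodup_of_allNew (acc := 0) (by decide +kernel)).1

theorem skeleton_deletions_nodup : (skeleton.flatMap deletions).Nodup :=
  (nodup_of_allNew (acc := 0) (by decide +kernel)).1

/-- The words are listed by decreasing dimension, which turns the count into an equality of lists.
-/
theorem skeleton_codeDim :
    skeleton.map codeDim = skeletonDims.flatMap fun x => List.replicate x.2 x.1 := by
  decide +kernel

theorem skeleton_inter {a b : ℕ} (ha : a ∈ skeleton) (hb : b ∈ skeleton) (hab : a ≠ b) :
    (pivots a ∩ pivots b).card + 2 ≤ 6 := by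
  by_contra! h
  obtain ⟨ha1, ha2, -⟩ := skeleton_weight a ha
  obtain ⟨hb1, hb2, -⟩ := skeleton_weight b hb
  obtain ⟨x, hxa, hxb⟩ := exists_common_deletion ha1 hb1 hab (ha2.trans hb2.symm) (by omega)
  have hdisj := (List.nodup_flatMap.1 skeleton_deletions_nodup).2
  have : Std.Symm (Function.onFun List.Disjoint deletions) := ⟨fun _ _ h => List.Disjoint.symm h⟩
  exact hdisj.forall ha hb hab hxa hxb

/-- The constant 81 is 6 · 16 minus the 15 pairs of pivots. The subtracted maximum bounds the free
rows (6) and the free columns (17 - 6 minus the lowest pivot). -/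
theorem codeDim_eq {a : ℕ} (ha : a ∈ skeleton) :
    codeDim a = (freeCells (pivots a)).card - max 6 (11 - (lowestPivot a).val) := by
  obtain ⟨-, h2, -⟩ := skeleton_weight a ha
  have h3 := card_freeCells (pivots a)
  have h4 : ∑ s ∈ pivots a, (17 - 1 - (s : ℕ)) + ∑ s ∈ pivots a, (s : ℕ) = 96 := by
    have h5 : ∀ s ∈ pivots a, 17 - 1 - (s : ℕ) + s = 16 := fun s _ => by omega
    rw [← Finset.sum_add_distrib, Finset.sum_congr rfl h5, Finset.sum_const, h2, smul_eq_mul]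
  rw [h2] at h3
  unfold codeDim
  omega

/-! ### The resulting bound and comparison with the stated polynomial. -/

theorem sum_skeletonDims_le_maxCDC (F : Type*) [Field F] [Finite F] :
    (skeletonDims.map fun x => x.2 * Nat.card F ^ x.1).sum ≤ maxCDC F 17 4 6 := by
  have hmem : ∀ i : skeleton.toFinset, i.1 ∈ skeleton := fun i => List.mem_toFinset.1 i.2
  have h := sum_pow_le_maxCDC (F := F) (n := 17) (k := 6)
    (fun i : skeleton.toFinset => pivots i) (fun i => (skeleton_weight i (hmem i)).2.1)
    (fun i j hij => skeleton_inter (hmem i) (hmem j) fun h => hij (Subtype.ext h))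
    (fun i => max 6 (11 - (lowestPivot i).val))
    (fun i => by
      have h1 := card_rows_freeCells_le (pivots i)
      rw [(skeleton_weight i (hmem i)).2.1] at h1
      exact h1.trans (le_max_left _ _))
    (fun i => by
      have h1 := card_columns_freeCells_le (pivots i) (lowestPivot i)
        (skeleton_weight i (hmem i)).2.2
      rw [(skeleton_weight i (hmem i)).2.1] at h1
      omega)
  refine le_trans (le_of_eq ?_) h
  rw [← Finset.sum_congr rfl fun i _ => congrArg (Nat.card F ^ ·) (codeDim_eq (hmem i)),
    Finset.sum_coe_sort skeleton.toFinset fun a => Nat.card F ^ codeDim a,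
    List.sum_toFinset _ skeleton_nodup,
    show (fun a => Nat.card F ^ codeDim a) = (Nat.card F ^ ·) ∘ codeDim from rfl,
    ← List.map_map, skeleton_codeDim, List.map_flatMap]
  simp [List.flatMap, List.sum_flatten, Function.comp_def]

theorem proposition3 (q : ℕ) (F : Type*) [Field F] [Finite F] (hq : Nat.card F = q) :
      q ^ 55 + q ^ 51 + q ^ 49 + 8 * q ^ 47 + 3 * q ^ 45 + 3 * q ^ 44 + 5 * q ^ 43 + q ^ 42
        + 5 * q ^ 41 + 9 * q ^ 40 + 22 * q ^ 39 + 7 * q ^ 38 + 11 * q ^ 37 + 13 * q ^ 36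
        + 19 * q ^ 35 + 3 * q ^ 34 + 17 * q ^ 33 + 15 * q ^ 32 + 69 * q ^ 31 + 20 * q ^ 30
        + 49 * q ^ 29 + 22 * q ^ 28 + 33 * q ^ 27 + 15 * q ^ 26 + 23 * q ^ 25 + 20 * q ^ 24
        + 38 * q ^ 23 + 17 * q ^ 22 + 29 * q ^ 21 + 24 * q ^ 20 + 40 * q ^ 19 + 19 * q ^ 18
        + 20 * q ^ 17 + 15 * q ^ 16 + 28 * q ^ 15 + 15 * q ^ 14 + 13 * q ^ 13 + 8 * q ^ 12
        + 7 * q ^ 11 + 5 * q ^ 10 + 3 * q ^ 9 + 10 * q ^ 8 + q ^ 7 + 2 * q ^ 6 + q ^ 5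
        + 2 * q ^ 4 + q ^ 3 + q ^ 2 + q ^ 1 + q ^ 0
      ≤ maxCDC F 17 4 6 := by
  refine le_trans ?_ (sum_skeletonDims_le_maxCDC F)
  have h2 : 2 ≤ q := hq ▸ Finite.one_lt_card
  have hpow : ∀ j ≤ 25, 2 ^ (25 - j) * q ^ j ≤ q ^ 25 := fun j hj =>
    (Nat.mul_le_mul_right _ (Nat.pow_le_pow_left h2 _)).trans_eq
      (by rw [← pow_add, Nat.sub_add_cancel hj])
  -- The left side collects all coefficients, at degree 19 and below, in which the code falls short
  -- of the stated polynomial. The code has five surplus terms `q ^ 25`, one of which suffices.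
  have hneg : 3 * q ^ 19 + 5 * q ^ 18 + 1 * q ^ 17 + 2 * q ^ 14 + 1 * q ^ 13
      + 1 * q ^ 12 + 1 * q ^ 10 + 2 * q ^ 8 + 1 * q ^ 4 + 1 * q ^ 1 ≤ q ^ 25 := by
    have h19 := hpow 19 (by norm_num)
    have h18 := hpow 18 (by norm_num)
    have h17 := hpow 17 (by norm_num)
    have h14 := hpow 14 (by norm_num)
    have h13 := hpow 13 (by norm_num)
    have h12 := hpow 12 (by norm_num)
    have h10 := hpow 10 (by norm_num)
    have h8 := hpow 8 (by norm_num)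
    have h4 := hpow 4 (by norm_num)
    have h1 := hpow 1 (by norm_num)
    omega
  simp only [skeletonDims, List.map_cons, List.map_nil, List.sum_cons, List.sum_nil, hq]
  omega
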